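/- Let $H\in(0,\frac12)$, $\alpha_{-1},\alpha_0,\alpha_1,\alpha_2>0$, $\tilde\theta>0$, $\rho>1+\frac{1}{H\tilde\theta}$, $\tilde\sigma>0$ and $x>0$. For $0<s\le 1$ and $0<y<\infty$ put $$\tilde f(s,y)=-\alpha_{-1}\tilde\theta\, y^{2\tilde\theta+1}+\alpha_0y^{\tilde\theta+1}-\alpha_1\frac{y}{\tilde\theta}+\alpha_2 s^{2H-1}\frac{1}{\tilde\theta^{\rho}}\, y^{-\tilde\theta\rho+\tilde\theta+1}-\tilde\sigma H s^{2H-1}(\tilde\theta+1)\,y^{-1}.$$ Let $(B^H_t)_{0\le t\le 1}$ be a scalar fractional Brownian motion with Hurst parameter $H$ on a probability space $(\Omega,\mathcal F,\mathbb P)$, that is, a centred Gaussian process with almost surely continuous paths and covariance $\mathbb E[B^H_tB^H_s]=\frac12\left(t^{2H}+s^{2H}-|t-s|^{2H}\right)$. Let $(x_t)_{0\le t\le 1}$ be a positive solution of $$x_t=x+\int_0^t\tilde f(s,x_s)\,ds-\tilde\sigma B^H_t,\qquad 0\le t\le 1,$$ that is, a process with almost surely continuous and strictly positive paths on $[0,1]$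 such that, almost surely, $s\mapsto\tilde f(s,x_s)$ is Lebesgue integrable on $[0,1]$ and the equation holds for all $t\in[0,1]$. Then $x_t\in L^q(\Omega)$ for all real $q\ge 1$ and all $t\in[0,1]$. -/

import Mathlib

open MeasureTheory ProbabilityTheory Set

/-- `B` is a scalar fractional Brownian motion on `[0,1]` with Hurst parameter `H`: a centred
Gaussian process with covariance `R_H(t,s) = (t^{2H} + s^{2H} - |t-s|^{2H}) / 2` and almost surely
continuous paths. Only the values `B t` with `t ∈ [0,1]` are constrained. -/
structure IsFractionalBrownianMotion {Ω : Type*} [MeasurableSpace Ω] (H : ℝ) (B : ℝ → Ω → ℝ)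
    (P : Measure Ω) : Prop where
  gaussian : IsGaussianProcess (fun t : Icc (0 : ℝ) 1 => B t) P
  centred : ∀ t ∈ Icc (0 : ℝ) 1, ∫ ω, B t ω ∂P = 0
  covariance : ∀ t ∈ Icc (0 : ℝ) 1, ∀ s ∈ Icc (0 : ℝ) 1,
    ∫ ω, B t ω * B s ω ∂P = (t ^ (2 * H) + s ^ (2 * H) - |t - s| ^ (2 * H)) / 2
  continuous_paths : ∀ᵐ ω ∂P, ContinuousOn (fun t => B t ω) (Icc 0 1)

/-- The drift of the transformed additive-noise equation, for `0 < s ≤ 1` and `0 < y`. Here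
`a₁' = α_{-1}`, `a₀ = α₀`, `a₁ = α₁`, `a₂ = α₂`, `θ` and `σ` are the tilded parameters. -/
noncomputable def transformedDrift (H a₁' a₀ a₁ a₂ θ ρ σ : ℝ) (s y : ℝ) : ℝ :=
  a₁' * (-θ * y ^ (2 * θ + 1)) + a₀ * y ^ (θ + 1) - a₁ * (y / θ)
    + a₂ * s ^ (2 * H - 1) * (1 / θ ^ ρ) * y ^ (-θ * ρ + θ + 1)
    - σ * H * s ^ (2 * H - 1) * y⁻¹ * (θ + 1)

/-- `X` is a positive solution on `[0,1]` of `X_t = x + ∫₀ᵗ b(s, X_s) ds - σ B_t`, where the drift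
`b` is only meaningful on `(0,1] × (0,∞)`: a process with continuous positive paths along which the
drift is Lebesgue integrable and the equation holds, almost surely for all `t` at once.
Adaptedness is not required, so every strong solution is a solution in this sense. -/
structure IsPositiveSolution {Ω : Type*} [MeasurableSpace Ω] (b : ℝ → ℝ → ℝ) (σ x : ℝ)
    (B X : ℝ → Ω → ℝ) (P : Measure Ω) : Prop where
  aemeasurable : ∀ t ∈ Icc (0 : ℝ) 1, AEMeasurable (X t) P
  continuous_paths : ∀ᵐ ω ∂P, ContinuousOn (fun t => X t ω) (Icc 0 1)
  pos : ∀ᵐ ω ∂P, ∀ t ∈ Icc (0 : ℝ) 1, 0 < X t ω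
  integrable_drift : ∀ᵐ ω ∂P, IntervalIntegrable (fun s => b s (X s ω)) volume 0 1
  equation : ∀ᵐ ω ∂P, ∀ t ∈ Icc (0 : ℝ) 1,
    X t ω = x + (∫ s in (0 : ℝ)..t, b s (X s ω)) - σ * B t ω

/-!
The drift pushes downwards at high levels, up to a singularity in time that is integrable: for
`y` above some level `m` the term `-a₁' θ y ^ (2θ + 1)` absorbs `a₀ y ^ (θ + 1)`, the linear term
and the `y⁻¹` term are nonpositive, and the remaining power of `y` is negative, so that the drift
at `(s, y)` is at most `g s = a₂ θ ^ (-ρ) s ^ (2H - 1)`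
(`exists_forall_transformedDrift_le`), which is integrable on `[0,1]` because `H > 0`. Looking back
from time `t` to the last time at which the path was at level `m` or below (or to time `0` if there
was none), the equation gives pathwise
`X t ≤ |x| + σ |B 0| + |m| + ∫₀¹ g + 2 σ sup_s |B s - B 0|` (`le_of_eq_add_integral_sub`).

It remains to see that the supremum of a fractional Brownian motion has moments of all orders.
The increment `B t - B s` is centred Gaussian with standard deviation `|t - s| ^ H`, so its `p`-th
moment is `C_p |t - s| ^ (H p)`. For `p > 1 / H`, dyadic chaining turns this into an `L^p` bound on
the supremum (`exists_memLp_forall_abs_sub_le`): for suitable `r < 1` the sum of the `p`-th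
powers of all dyadic increments, those of generation `n` being divided by `r ^ n`, has finite
expectation; its `p`-th root `K` bounds every increment of generation `n` by `K r ^ n`, and
the geometric series adds up to `|B t - B 0| ≤ K / (1 - r)` at all times by continuity
(`abs_sub_le_of_dyadic_increments`).
-/

/-! ### Dyadic chaining -/

/-- If the increments of a continuous path over the dyadic intervals of generation `n` are at most
`K * r ^ n`, then the path stays within the sum of the geometric series of its starting point: a
grid point of generation `n + 1` is at most one increment away from a grid point of generation `n`. -/
lemma abs_sub_le_of_dyadic_increments {β : ℝ → ℝ} {K r : ℝ} (hβ : ContinuousOn β (Icc 0 1))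
    (hr₀ : 0 ≤ r) (hr₁ : r < 1) (hK : 0 ≤ K)
    (h : ∀ n k : ℕ, k < 2 ^ n → |β (((k + 1 : ℕ) : ℝ) / 2 ^ n) - β ((k : ℝ) / 2 ^ n)| ≤ K * r ^ n)
    {t : ℝ} (ht : t ∈ Icc (0 : ℝ) 1) : |β t - β 0| ≤ K * (1 - r)⁻¹ := by
  have hgrid : ∀ n k : ℕ, k ≤ 2 ^ n →
      |β ((k : ℝ) / 2 ^ n) - β 0| ≤ K * ∑ j ∈ Finset.range (n + 1), r ^ j := by
    intro n
    induction n with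
    | zero =>
      intro k hk
      rcases Nat.le_one_iff_eq_zero_or_eq_one.mp (by simpa using hk) with rfl | rfl
      · simpa using hK
      · simpa using h 0 0 (by norm_num)
    | succ n ih =>
      intro k hk
      rw [Finset.sum_range_succ, mul_add]
      have hpow : 0 ≤ K * r ^ (n + 1) := by positivity
      have hhalf (j : ℕ) : ((2 * j : ℕ) : ℝ) / 2 ^ (n + 1) = (j : ℝ) / 2 ^ n := by
        push_cast; field_simp; ring
      rw [pow_succ] at hk
      obtain ⟨j, rfl | rfl⟩ := k.even_or_odd'
      · rw [hhalf]
        linarith [ih j (by omega)]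
      · have h1 := ih j (by omega)
        have h2 := h (n + 1) (2 * j) (by rw [pow_succ]; omega)
        rw [hhalf] at h2
        calc _ ≤ _ := abs_sub_le _ (β ((j : ℝ) / 2 ^ n)) _
          _ ≤ _ := by linarith
  have hpt (n : ℕ) : ((⌊t * 2 ^ n⌋₊ : ℝ) / 2 ^ n) ∈ Icc (0 : ℝ) 1 := by
    refine ⟨by positivity, ?_⟩
    rw [div_le_one (by positivity)]
    refine (Nat.floor_le (by have := ht.1; positivity)).trans ?_
    nlinarith [ht.2, pow_pos (two_pos (α := ℝ)) n]
  have hlim : Filter.Tendsto (fun n : ℕ => (⌊t * 2 ^ n⌋₊ : ℝ) / 2 ^ n) Filter.atTop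
      (nhdsWithin t (Icc 0 1)) :=
    tendsto_nhdsWithin_iff.mpr ⟨(tendsto_nat_floor_mul_div_atTop ht.1).comp
      (tendsto_pow_atTop_atTop_of_one_lt one_lt_two), .of_forall hpt⟩
  refine le_of_tendsto (((hβ t ht).tendsto.comp hlim).sub_const (β 0)).abs (.of_forall fun n => ?_)
  refine (hgrid n _ ?_).trans (mul_le_mul_of_nonneg_left ?_ hK)
  · have := (hpt n).2
    rw [div_le_one (by positivity)] at this
    exact_mod_cast this
  · exact (tsum_geometric_of_lt_one hr₀ hr₁).symm ▸
      (summable_geometric_of_lt_one hr₀ hr₁).sum_le_tsum _ fun _ _ => by positivity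

/-- Maximal inequality by chaining: if `p`-th moments of increments are of order `|t - s| ^ (H * p)`
with `H * p > 1`, the oscillation of a continuous process on `[0,1]` around its initial value is
dominated by a variable in `L^p`. A dominating variable replaces the supremum, whose measurability
is thereby not an issue. -/
lemma exists_memLp_forall_abs_sub_le {Ω : Type*} [MeasurableSpace Ω] {P : Measure Ω}
    {B : ℝ → Ω → ℝ} {H : ℝ} {p : ℕ} {C : ENNReal} (hC : C ≠ ⊤) (hp : 1 ≤ p) (hpH : 1 < H * p)
    (hmeas : ∀ t ∈ Icc (0 : ℝ) 1, AEMeasurable (B t) P)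
    (hcont : ∀ᵐ ω ∂P, ContinuousOn (fun t => B t ω) (Icc 0 1))
    (hmom : ∀ t ∈ Icc (0 : ℝ) 1, ∀ s ∈ Icc (0 : ℝ) 1,
      ∫⁻ ω, ‖B t ω - B s ω‖ₑ ^ p ∂P ≤ ENNReal.ofReal (|t - s| ^ H) ^ p * C) :
    ∃ S : Ω → ℝ, MemLp S p P ∧ ∀ᵐ ω ∂P, ∀ t ∈ Icc (0 : ℝ) 1, |B t ω - B 0 ω| ≤ S ω := by
  set a : ℝ := 2 ^ (-H) with ha
  have ha0 : 0 < a := by positivity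
  have hap : 2 * a ^ p < 1 := by
    rw [ha, ← Real.rpow_natCast, ← Real.rpow_mul zero_le_two]
    nth_rewrite 1 [← Real.rpow_one 2]
    rw [← Real.rpow_add two_pos]
    exact Real.rpow_lt_one_of_one_lt_of_neg one_lt_two (by linarith)
  -- The inequality `2 * (r⁻¹ * a) ^ p < 1` holds at `r = 1`, hence also slightly below it.
  obtain ⟨r, hr1, hr0, hr⟩ : ∃ r : ℝ, r < 1 ∧ 0 < r ∧ 2 * (r⁻¹ * a) ^ p < 1 := by
    have hc : ContinuousAt (fun r : ℝ => 2 * (r⁻¹ * a) ^ p) 1 := by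
      fun_prop (disch := norm_num)
    have h1 := (hc.eventually (eventually_lt_nhds (b := 1) (by simpa using hap))).and
      (eventually_gt_nhds (zero_lt_one (α := ℝ)))
    obtain ⟨r, hr, hr1⟩ := ((h1.filter_mono nhdsWithin_le_nhds).and
      (self_mem_nhdsWithin (s := Iio (1 : ℝ)))).exists
    exact ⟨r, hr1, hr.2, hr.1⟩
  have hmem (n k : ℕ) (hk : k ≤ 2 ^ n) : (k : ℝ) / 2 ^ n ∈ Icc (0 : ℝ) 1 := by
    refine ⟨by positivity, ?_⟩
    rw [div_le_one (by positivity)]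
    exact_mod_cast hk
  let I (n k : ℕ) (ω : Ω) : ℝ :=
    r⁻¹ ^ n * (B (((k + 1 : ℕ) : ℝ) / 2 ^ n) ω - B ((k : ℝ) / 2 ^ n) ω)
  -- The `2 ^ n` increments of generation `n` contribute at most `C * (2 * (r⁻¹ * a) ^ p) ^ n`
  -- to the expectation of `Y`.
  let Y (ω : Ω) : ENNReal := ∑' n : ℕ, ∑ k ∈ Finset.range (2 ^ n), ‖I n k ω‖ₑ ^ p
  have hImeas (n k : ℕ) (hk : k ∈ Finset.range (2 ^ n)) :
      AEMeasurable (fun ω => ‖I n k ω‖ₑ ^ p) P := by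
    rw [Finset.mem_range] at hk
    have h1 := hmeas _ (hmem n k hk.le)
    have h2 := hmeas _ (hmem n (k + 1) hk)
    exact (((h2.sub h1).const_mul (r⁻¹ ^ n)).enorm).pow_const p
  have hsum (n : ℕ) :
      AEMeasurable (fun ω => ∑ k ∈ Finset.range (2 ^ n), ‖I n k ω‖ₑ ^ p) P :=
    Finset.aemeasurable_fun_sum _ (hImeas n)
  have hYmeas : AEMeasurable Y P := AEMeasurable.tsum hsum
  have hYint : ∫⁻ ω, Y ω ∂P ≠ ⊤ := by
    have hle (n k : ℕ) (hk : k ∈ Finset.range (2 ^ n)) :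
        ∫⁻ ω, ‖I n k ω‖ₑ ^ p ∂P ≤ ENNReal.ofReal (((r⁻¹ * a) ^ p) ^ n) * C := by
      rw [Finset.mem_range] at hk
      have h1 := hmom _ (hmem n (k + 1) hk) _ (hmem n k hk.le)
      have h2 : |((k + 1 : ℕ) : ℝ) / 2 ^ n - (k : ℝ) / 2 ^ n| ^ H = a ^ n := by
        have : ((k + 1 : ℕ) : ℝ) / 2 ^ n - (k : ℝ) / 2 ^ n = (2 : ℝ) ^ (-(n : ℝ)) := by
          rw [Real.rpow_neg zero_le_two, Real.rpow_natCast]; push_cast; field_simp; ring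
        rw [this, abs_of_pos (by positivity), ha, ← Real.rpow_natCast, ← Real.rpow_mul zero_le_two,
          ← Real.rpow_mul zero_le_two]
        ring_nf
      rw [h2] at h1
      simp only [I, enorm_mul, mul_pow]
      rw [lintegral_const_mul' _ _ (by finiteness)]
      refine (mul_le_mul_right h1 _).trans_eq ?_
      rw [← mul_assoc, Real.enorm_eq_ofReal (by positivity), ← mul_pow,
        ← ENNReal.ofReal_mul (by positivity), ← ENNReal.ofReal_pow (by positivity)]
      ring_nf
    have hbound : ∫⁻ ω, Y ω ∂P ≤ ∑' n : ℕ, ENNReal.ofReal (2 * (r⁻¹ * a) ^ p) ^ n * C := by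
      rw [lintegral_tsum hsum]
      refine ENNReal.tsum_le_tsum fun n => ?_
      rw [lintegral_finsetSum' _ (hImeas n)]
      refine (Finset.sum_le_sum (hle n)).trans_eq ?_
      rw [Finset.sum_const, Finset.card_range, nsmul_eq_mul, ← mul_assoc,
        ENNReal.ofReal_mul zero_le_two, mul_pow (ENNReal.ofReal 2),
        ENNReal.ofReal_pow (show 0 ≤ (r⁻¹ * a) ^ p by positivity)]
      simp
    refine (hbound.trans_lt ?_).ne
    rw [ENNReal.tsum_mul_right, ENNReal.tsum_geometric]
    refine ENNReal.mul_lt_top ?_ hC.lt_top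
    rw [ENNReal.inv_lt_top, tsub_pos_iff_lt]
    exact ENNReal.ofReal_lt_one.mpr hr
  have hp0 : (p : ℝ) ≠ 0 := by positivity
  have hK : MemLp (fun ω => (Y ω).toReal ^ (1 / (p : ℝ))) p P := by
    have h1 := (memLp_one_iff_integrable.mpr
      (integrable_toReal_of_lintegral_ne_top hYmeas hYint)).norm_rpow_div (1 / (p : ENNReal))
    simpa using h1
  refine ⟨fun ω => (Y ω).toReal ^ (1 / (p : ℝ)) * (1 - r)⁻¹, hK.mul_const _, ?_⟩
  filter_upwards [hcont, ae_lt_top' hYmeas hYint] with ω hω hYω t ht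
  refine abs_sub_le_of_dyadic_increments hω hr0.le hr1 (by positivity) (fun n k hk => ?_) ht
  have h1 : ‖I n k ω‖ₑ ^ p ≤ Y ω :=
    (Finset.single_le_sum (f := fun k => ‖I n k ω‖ₑ ^ p) (fun _ _ => zero_le)
      (Finset.mem_range.mpr hk)).trans (ENNReal.le_tsum n)
  have h2 : |I n k ω| ^ p ≤ (Y ω).toReal := by
    simpa using ENNReal.toReal_mono hYω.ne h1
  have h3 : |I n k ω| ≤ (Y ω).toReal ^ (1 / (p : ℝ)) := by
    rw [one_div, Real.le_rpow_inv_iff_of_pos (abs_nonneg _) ENNReal.toReal_nonneg (by positivity)]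
    simpa using h2
  simp only [I, abs_mul, inv_pow, abs_of_pos (inv_pos.mpr (pow_pos hr0 n))] at h3
  rwa [inv_mul_le_iff₀ (by positivity), mul_comm] at h3

/-! ### Moments of fractional Brownian motion -/

lemma lintegral_enorm_pow_of_gaussian {Ω : Type*} [MeasurableSpace Ω] {P : Measure Ω}
    {Y : Ω → ℝ} (hY : HasGaussianLaw Y P) (h0 : ∫ ω, Y ω ∂P = 0) {a : ℝ} (ha : 0 ≤ a)
    (h2 : ∫ ω, Y ω ^ 2 ∂P = a ^ 2) (p : ℕ) :
    ∫⁻ ω, ‖Y ω‖ₑ ^ p ∂P = ENNReal.ofReal a ^ p * ∫⁻ z, ‖z‖ₑ ^ p ∂(gaussianReal 0 1) := by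
  have hvar : Var[Y; P] = a ^ 2 := by
    rw [variance_of_integral_eq_zero hY.aemeasurable h0, h2]
  have hmap : P.map Y = (gaussianReal 0 1).map (a * ·) := by
    rw [hY.map_eq_gaussianReal, gaussianReal_map_const_mul, h0, hvar]
    congr 1
    · simp
    · ext
      simp [sq_nonneg]
  have hm : Measurable fun z : ℝ => ‖z‖ₑ ^ p := by fun_prop
  rw [← lintegral_map' hm.aemeasurable hY.aemeasurable, hmap, lintegral_map hm (by fun_prop),
    ← lintegral_const_mul _ hm]
  simp [enorm_mul, mul_pow, Real.enorm_eq_ofReal ha]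

lemma IsFractionalBrownianMotion.lintegral_enorm_sub_pow {Ω : Type*} [MeasurableSpace Ω]
    {P : Measure Ω} {H : ℝ} (hH : 0 < H) {B : ℝ → Ω → ℝ} (hB : IsFractionalBrownianMotion H B P)
    {t s : ℝ} (ht : t ∈ Icc (0 : ℝ) 1) (hs : s ∈ Icc (0 : ℝ) 1) (p : ℕ) :
    ∫⁻ ω, ‖B t ω - B s ω‖ₑ ^ p ∂P =
      ENNReal.ofReal (|t - s| ^ H) ^ p * ∫⁻ z, ‖z‖ₑ ^ p ∂(gaussianReal 0 1) := by
  have ht' := hB.gaussian.hasGaussianLaw_eval ⟨t, ht⟩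
  have hs' := hB.gaussian.hasGaussianLaw_eval ⟨s, hs⟩
  have hmul {u v : ℝ} (hu : HasGaussianLaw (B u) P) (hv : HasGaussianLaw (B v) P) :
      Integrable (fun ω => B u ω * B v ω) P := hu.memLp_two.integrable_mul hv.memLp_two
  refine lintegral_enorm_pow_of_gaussian
    (hB.gaussian.hasGaussianLaw_fun_sub (s := ⟨t, ht⟩) (t := ⟨s, hs⟩)) ?_ (by positivity) ?_ p
  · rw [integral_sub ht'.integrable hs'.integrable, hB.centred t ht, hB.centred s hs, sub_zero]
  · have hexp (ω : Ω) : (B t ω - B s ω) ^ 2 =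
        B t ω * B t ω - 2 * (B t ω * B s ω) + B s ω * B s ω := by ring
    simp_rw [hexp]
    have h1 := hmul ht' ht'
    have h2 := (hmul ht' hs').const_mul 2
    rw [integral_add (f := fun ω => B t ω * B t ω - 2 * (B t ω * B s ω)) (h1.sub h2)
      (hmul hs' hs'), integral_sub h1 h2, integral_const_mul,
      hB.covariance t ht t ht, hB.covariance t ht s hs, hB.covariance s hs s hs]
    rw [sub_self, sub_self, abs_zero, Real.zero_rpow (by positivity), ← Real.rpow_natCast,
      ← Real.rpow_mul (abs_nonneg _), mul_comm H]
    push_cast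
    ring

/-- The oscillation of a fractional Brownian motion around its initial value is dominated by a
variable in `L^p`, for every `p > 1 / H`. -/
lemma IsFractionalBrownianMotion.exists_memLp_forall_abs_sub_le {Ω : Type*} [MeasurableSpace Ω]
    {P : Measure Ω} {H : ℝ} (hH : 0 < H) {B : ℝ → Ω → ℝ} (hB : IsFractionalBrownianMotion H B P)
    {p : ℕ} (hp : 1 ≤ p) (hpH : 1 < H * p) :
    ∃ S : Ω → ℝ, MemLp S p P ∧ ∀ᵐ ω ∂P, ∀ t ∈ Icc (0 : ℝ) 1, |B t ω - B 0 ω| ≤ S ω := by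
  have hC : ∫⁻ z, ‖z‖ₑ ^ p ∂(gaussianReal 0 1) ≠ ⊤ := by
    have h1 := (IsGaussian.memLp_id (gaussianReal 0 1) p (by simp)).eLpNorm_lt_top
    rw [eLpNorm_lt_top_iff_lintegral_rpow_enorm_lt_top (by simp; omega) (by simp)] at h1
    simpa using h1.ne
  exact _root_.exists_memLp_forall_abs_sub_le hC hp hpH
    (fun s hs => (hB.gaussian.hasGaussianLaw_eval ⟨s, hs⟩).aemeasurable) hB.continuous_paths
    fun t ht s hs => (hB.lintegral_enorm_sub_pow hH ht hs p).le

/-! ### The pathwise bound -/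

/-- A path driven by `u` and `-σ * β` whose drift `u` is at most `g` above the level `m` is bounded
in terms of `m`, the integral of `g` and the oscillation `S` of `β`. -/
lemma le_of_eq_add_integral_sub {f β u g : ℝ → ℝ} {x σ m S : ℝ} (hσ : 0 ≤ σ)
    (hf : ContinuousOn f (Icc 0 1)) (hu : IntervalIntegrable u volume 0 1)
    (hg : IntervalIntegrable g volume 0 1) (hg₀ : ∀ s ∈ Icc (0 : ℝ) 1, 0 ≤ g s)
    (hug : ∀ s ∈ Icc (0 : ℝ) 1, m ≤ f s → u s ≤ g s)
    (heq : ∀ t ∈ Icc (0 : ℝ) 1, f t = x + (∫ s in (0 : ℝ)..t, u s) - σ * β t)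
    (hβ : ∀ t ∈ Icc (0 : ℝ) 1, |β t - β 0| ≤ S) {t : ℝ} (ht : t ∈ Icc (0 : ℝ) 1) :
    f t ≤ |x| + σ * |β 0| + |m| + (∫ s in (0 : ℝ)..1, g s) + 2 * σ * S := by
  have hsub {c d : ℝ} (hc : 0 ≤ c) (hcd : c ≤ d) (hd : d ≤ 1) : uIcc c d ⊆ uIcc 0 1 := by
    rw [uIcc_of_le hcd, uIcc_of_le zero_le_one]
    exact Icc_subset_Icc hc hd
  have hgint : 0 ≤ ∫ s in (0 : ℝ)..1, g s := intervalIntegral.integral_nonneg zero_le_one hg₀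
  have hS : 0 ≤ S := (abs_nonneg _).trans (hβ t ht)
  have hx := neg_abs_le (β 0)
  have hxa := le_abs_self x
  have hma := le_abs_self m
  have hma0 := abs_nonneg m
  have hxa0 := abs_nonneg x
  have hσβ : 0 ≤ σ * |β 0| := by positivity
  have hσS : 0 ≤ σ * S := by positivity
  -- The bound for an excursion above `m` during `(τ, t)`.
  have hexc {τ : ℝ} (hτ : τ ∈ Icc (0 : ℝ) t) (habove : ∀ s ∈ Ioo τ t, m ≤ f s) :
      f t ≤ f τ + (∫ s in (0 : ℝ)..1, g s) + 2 * σ * S := by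
    have hτ1 : τ ∈ Icc (0 : ℝ) 1 := ⟨hτ.1, hτ.2.trans ht.2⟩
    have h1 : (∫ s in (0 : ℝ)..t, u s) - ∫ s in (0 : ℝ)..τ, u s = ∫ s in τ..t, u s :=
      intervalIntegral.integral_interval_sub_left (hu.mono_set (hsub le_rfl ht.1 ht.2))
        (hu.mono_set (hsub le_rfl hτ.1 hτ1.2))
    have h2 : ∫ s in τ..t, u s ≤ ∫ s in τ..t, g s :=
      intervalIntegral.integral_mono_on_of_le_Ioo hτ.2 (hu.mono_set (hsub hτ.1 hτ.2 ht.2))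
        (hg.mono_set (hsub hτ.1 hτ.2 ht.2)) fun s hs =>
          hug s ⟨hτ.1.trans hs.1.le, hs.2.le.trans ht.2⟩ (habove s hs)
    have h3 : ∫ s in τ..t, g s ≤ ∫ s in (0 : ℝ)..1, g s := by
      refine intervalIntegral.integral_mono_interval hτ.1 hτ.2 ht.2 ?_ hg
      filter_upwards [ae_restrict_mem measurableSet_Ioc] with s hs
      exact hg₀ s ⟨hs.1.le, hs.2⟩
    have h4 : -(2 * S) ≤ β t - β τ := by
      have := abs_le.mp (hβ t ht)
      have := abs_le.mp (hβ τ hτ1)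
      linarith
    have h5 := mul_le_mul_of_nonneg_left h4 hσ
    rw [heq t ht, heq τ hτ1]
    linarith
  -- The path is above `m` after the last time `τ ≤ t` at which it is at most `m`.
  have hclosed : IsCompact {s ∈ Icc (0 : ℝ) t | f s ≤ m} := by
    have := (hf.mono (Icc_subset_Icc_right ht.2)).preimage_isClosed_of_isClosed isClosed_Icc
      (isClosed_Iic (a := m))
    exact isCompact_Icc.of_isClosed_subset this inter_subset_left
  rcases eq_empty_or_nonempty {s ∈ Icc (0 : ℝ) t | f s ≤ m} with hemp | hne
  · have h1 := hexc (τ := 0) ⟨le_rfl, ht.1⟩ fun s hs => by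
      by_contra! hlt
      exact (eq_empty_iff_forall_notMem.mp hemp s) ⟨⟨hs.1.le, hs.2.le⟩, hlt.le⟩
    have h2 := heq 0 ⟨le_rfl, zero_le_one⟩
    rw [intervalIntegral.integral_same] at h2
    have h3 := mul_le_mul_of_nonneg_left hx hσ
    linarith
  · obtain ⟨τ, ⟨hτ, hτm⟩, hmax⟩ := hclosed.exists_isGreatest hne
    have h1 := hexc hτ fun s hs => by
      by_contra! hlt
      exact hs.1.not_ge (hmax ⟨⟨hτ.1.trans hs.1.le, hs.2.le⟩, hlt.le⟩)
    linarith

/-- Above a level not depending on time, only the term with a negative power of `y` can be positive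
in the drift. The condition on `ρ` makes the exponent `-θ * ρ + θ + 1` nonpositive. -/
lemma exists_forall_transformedDrift_le {H a₁' a₀ a₁ a₂ θ ρ σ : ℝ} (hH : 0 < H)
    (ha₁' : 0 < a₁') (ha₁ : 0 < a₁) (ha₂ : 0 < a₂) (hθ : 0 < θ)
    (hρ : 1 + 1 / θ ≤ ρ) (hσ : 0 < σ) :
    ∃ m : ℝ, ∀ s y : ℝ, 0 ≤ s → m ≤ y →
      transformedDrift H a₁' a₀ a₁ a₂ θ ρ σ s y ≤ a₂ * (1 / θ ^ ρ) * s ^ (2 * H - 1) := by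
  have hlim := (tendsto_rpow_atTop hθ).eventually_ge_atTop (a₀ / (a₁' * θ))
  obtain ⟨m, hm⟩ := Filter.eventually_atTop.mp (hlim.and (Filter.eventually_ge_atTop 1))
  refine ⟨m, fun s y hs hy => ?_⟩
  obtain ⟨hyθ, hy1⟩ := hm y hy
  have hy0 : 0 < y := by linarith
  -- Up to the positive factor `y ^ (θ + 1)` this is `a₀ - a₁' * θ * y ^ θ`.
  have h1 : a₁' * (-θ * y ^ (2 * θ + 1)) + a₀ * y ^ (θ + 1) ≤ 0 := by
    have : y ^ (2 * θ + 1) = y ^ θ * y ^ (θ + 1) := by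
      rw [← Real.rpow_add hy0]; ring_nf
    rw [div_le_iff₀ (by positivity)] at hyθ
    rw [this]
    nlinarith [Real.rpow_pos_of_pos hy0 (θ + 1)]
  have h2 : y ^ (-θ * ρ + θ + 1) ≤ 1 := by
    refine Real.rpow_le_one_of_one_le_of_nonpos hy1 ?_
    have := mul_le_mul_of_nonneg_left hρ hθ.le
    field_simp at this
    linarith
  have h3 : 0 ≤ a₁ * (y / θ) := by positivity
  have h4 : 0 ≤ σ * H * s ^ (2 * H - 1) * y⁻¹ * (θ + 1) := by positivity
  have h5 := mul_le_mul_of_nonneg_left h2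
    (show 0 ≤ a₂ * s ^ (2 * H - 1) * (1 / θ ^ ρ) by positivity)
  unfold transformedDrift
  linarith

/-! ### Moments of the solution -/

theorem theorem4p1 {Ω : Type*} [MeasurableSpace Ω] (P : Measure Ω) [IsProbabilityMeasure P]
    (H a₁' a₀ a₁ a₂ θ ρ σ x : ℝ)
    (hH₀ : 0 < H) (hH₁ : H < 1 / 2)
    (ha₁' : 0 < a₁') (ha₀ : 0 < a₀) (ha₁ : 0 < a₁) (ha₂ : 0 < a₂)
    (hθ : 0 < θ) (hρ : 1 + 1 / (H * θ) < ρ) (hσ : 0 < σ) (hx : 0 < x)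
    (B X : ℝ → Ω → ℝ)
    (hB : IsFractionalBrownianMotion H B P)
    (hX : IsPositiveSolution (transformedDrift H a₁' a₀ a₁ a₂ θ ρ σ) σ x B X P)
    (q : ℝ) (hq : 1 ≤ q) (t : ℝ) (ht : t ∈ Icc (0 : ℝ) 1) :
    MemLp (X t) (ENNReal.ofReal q) P := by
  -- `L^p ⊆ L^q` lets `p` be as large as the chaining bound needs, that is `p > 1 / H`.
  obtain ⟨p, hp⟩ := exists_nat_gt (max q (1 / H))
  have hqp : q < p := (le_max_left _ _).trans_lt hp
  have hpH : 1 < H * p := by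
    rw [mul_comm, ← div_lt_iff₀ hH₀]
    exact (le_max_right _ _).trans_lt hp
  have hp1 : 1 ≤ p := by exact_mod_cast (hq.trans hqp.le)
  obtain ⟨S, hS, hBS⟩ := hB.exists_memLp_forall_abs_sub_le hH₀ hp1 hpH
  have hρ' : 1 + 1 / θ ≤ ρ := by
    -- `H < 1`, so `1 / θ < 1 / (H * θ)`.
    refine le_trans ?_ hρ.le
    gcongr
    nlinarith
  obtain ⟨m, hm⟩ := exists_forall_transformedDrift_le (a₀ := a₀) hH₀ ha₁' ha₁ ha₂ hθ hρ' hσ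
  let g (s : ℝ) : ℝ := a₂ * (1 / θ ^ ρ) * s ^ (2 * H - 1)
  have hg : IntervalIntegrable g volume 0 1 :=
    (intervalIntegral.intervalIntegrable_rpow' (by linarith)).const_mul _
  have hg₀ (s : ℝ) (hs : s ∈ Icc (0 : ℝ) 1) : 0 ≤ g s := by
    have := hs.1
    positivity
  have hB0 : MemLp (B 0) p P := (hB.gaussian.hasGaussianLaw_eval ⟨0, by simp⟩).memLp (by simp)
  have hdom (c : ℝ) : MemLp (fun ω => c + σ * ‖B 0 ω‖ + 2 * σ * S ω) p P :=
    ((memLp_const c).add (hB0.norm.const_mul σ)).add (hS.const_mul (2 * σ))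
  have hXp : MemLp (X t) p P := by
    refine (hdom (|x| + |m| + ∫ s in (0 : ℝ)..1, g s)).mono'
      (hX.aemeasurable t ht).aestronglyMeasurable ?_
    filter_upwards [hX.continuous_paths, hX.pos, hX.integrable_drift, hX.equation, hBS]
      with ω hcont hpos hint heq hS
    rw [Real.norm_of_nonneg (hpos t ht).le]
    have := le_of_eq_add_integral_sub hσ.le hcont hint hg hg₀ (fun s hs => hm s _ hs.1) heq hS ht
    rw [Real.norm_eq_abs]
    linarith
  refine hXp.mono_exponent ?_
  rw [← ENNReal.ofReal_natCast]
  exact ENNReal.ofReal_le_ofReal hqp.le
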